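/- Let $d_1\le d_2$ be non-negative integers, $R=\mathbb{C}[a,b,c,d]$, and $$J=(a,b)^{d_1}\cap(c,d)^{d_2}\cap(a-c,b-d)^{d_1}\subseteq R .$$ Grade $R$ by giving $a,c$ bidegree $q$ and $b,d$ bidegree $t$; a nonzero bihomogeneous polynomial of bidegree $q^xt^y$ has $\deg_q=x$ and $\deg_t=y$. For $0\le j\le d_1$ put $$A_{i,j}=a^{d_1-j}c^{d_2-j}(a-c)^{i}(b-d)^{d_1-j-i}(ad-bc)^{j}\quad(1\le i\le d_1-j),$$ $$B_{i,j}=a^{d_1-j-i}b^{i}d^{d_2-j}(b-d)^{d_1-j}(ad-bc)^{j}\quad(1\le i\le d_1-j),$$ $$C_{i,j}=a^{d_1-j}c^{i}d^{d_2-j-i}(b-d)^{d_1-j}(ad-bc)^{j}\quad(1\le i\le d_2-j),$$ $$D_{j}=a^{d_1-j}d^{d_2-j}(b-d)^{d_1-j}(ad-bc)^{j}$$ (so for $j=d_1$ there are no $A_{i,j}$ and no $B_{i,j}$). Then: 1. The polynomials $A_{i,j},B_{i,j},C_{i,j},D_j$ generate the ideal $J$. 2. They are nonzero and bihomogeneous: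 $A_{i,j}$ has bidegree $q^{d_1+d_2-j+i}t^{d_1-i}$, $B_{i,j}$ has bidegree $q^{d_1-i}t^{d_1+d_2-j+i}$, $C_{i,j}$ has bidegree $q^{d_1+i}t^{d_1+d_2-j-i}$, and $D_j$ has bidegree $q^{d_1}t^{d_1+d_2-j}$. 3. For each fixed $j$ with $0\le j\le d_1$ there are exactly $d_1-j$ polynomials $A_{i,j}$, exactly $d_1-j$ polynomials $B_{i,j}$, and exactly $d_2-j$ polynomials $C_{i,j}$; there is one $D_j$ for each $j$, and $D_0,\dots,D_{d_1}$ are pairwise distinct. 4. Among these generators, those of the family $A$ are exactly the ones with $\deg_t<d_1$, those of the family $B$ exactly the ones with $\deg_q<d_1$, those of the family $C$ exactly the ones with $\deg_q>d_1$ and $\deg_t\ge d_1$, and those of the family $D$ exactly the ones with $\deg_q=d_1$. 5. The following set of polynomials is a basis of $J$ over $\mathbb{C}$ (a polynomial that can be written in several of these ways is taken once): - $a^{\alpha}c^{\gamma}A_{i,j}$ with $0\le j\le d_1-1$, $1\le i\le d_1-j$; - $a^{\alpha}b^{\beta}d^{\delta}B_{i,j}$ with $0\le j\le d_1-1$, $1\le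 i\le d_1-j$; - $a^{\alpha}c^{\gamma}d^{\delta}C_{i,j}$ with $0\le j\le d_1-1$, $1\le i\le d_2-j$; - $a^{\alpha}d^{\delta}D_{j}$ with $0\le j\le d_1-1$; - $a^{\alpha}b^{\beta}c^{\gamma}d^{\delta}(ad-bc)^{d_1}$ with $\gamma+\delta\ge d_2-d_1$; where $\alpha,\beta,\gamma,\delta$ run over all non-negative integers (subject to the stated condition in the last family). -/

import Mathlib

open MvPolynomial

noncomputable section

namespace TripleIdeal

/-- The polynomial ring `ℂ[a, b, c, d]`. -/
abbrev R : Type := MvPolynomial (Fin 4) ℂ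

/-- The four variables. -/
def a : R := X 0
def b : R := X 1
def c : R := X 2
def d : R := X 3

/-- The ideal `J(d₁, d₂) = (a, b)^d₁ ∩ (c, d)^d₂ ∩ (a - c, b - d)^d₁`. -/
def J (d₁ d₂ : ℕ) : Ideal R :=
  Ideal.span {a, b} ^ d₁ ⊓ Ideal.span {c, d} ^ d₂ ⊓ Ideal.span {a - c, b - d} ^ d₁

/-- The four families of polynomials; only used in the ranges of `i`, `j` where all the
differences in the exponents are true differences of natural numbers. -/
def A (d₁ d₂ i j : ℕ) : R :=
  a ^ (d₁ - j) * c ^ (d₂ - j) * (a - c) ^ i * (b - d) ^ (d₁ - j - i) * (a * d - b * c) ^ j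

def B (d₁ d₂ i j : ℕ) : R :=
  a ^ (d₁ - j - i) * b ^ i * d ^ (d₂ - j) * (b - d) ^ (d₁ - j) * (a * d - b * c) ^ j

def C (d₁ d₂ i j : ℕ) : R :=
  a ^ (d₁ - j) * c ^ i * d ^ (d₂ - j - i) * (b - d) ^ (d₁ - j) * (a * d - b * c) ^ j

def D (d₁ d₂ j : ℕ) : R :=
  a ^ (d₁ - j) * d ^ (d₂ - j) * (b - d) ^ (d₁ - j) * (a * d - b * c) ^ j

/-- The members of each family with a fixed second index `j`. -/
def rowA (d₁ d₂ j : ℕ) : Set R := {g | ∃ i, 1 ≤ i ∧ i ≤ d₁ - j ∧ g = A d₁ d₂ i j}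

def rowB (d₁ d₂ j : ℕ) : Set R := {g | ∃ i, 1 ≤ i ∧ i ≤ d₁ - j ∧ g = B d₁ d₂ i j}

def rowC (d₁ d₂ j : ℕ) : Set R := {g | ∃ i, 1 ≤ i ∧ i ≤ d₂ - j ∧ g = C d₁ d₂ i j}

/-- The whole families, over `0 ≤ j ≤ d₁`. -/
def famA (d₁ d₂ : ℕ) : Set R := {g | ∃ j ≤ d₁, g ∈ rowA d₁ d₂ j}

def famB (d₁ d₂ : ℕ) : Set R := {g | ∃ j ≤ d₁, g ∈ rowB d₁ d₂ j}

def famC (d₁ d₂ : ℕ) : Set R := {g | ∃ j ≤ d₁, g ∈ rowC d₁ d₂ j}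

def famD (d₁ d₂ : ℕ) : Set R := {g | ∃ j ≤ d₁, g = D d₁ d₂ j}

def generators (d₁ d₂ : ℕ) : Set R :=
  famA d₁ d₂ ∪ famB d₁ d₂ ∪ famC d₁ d₂ ∪ famD d₁ d₂

/-- `g` is nonzero and bihomogeneous of bidegree `q^x t^y`, where `a`, `c` have bidegree `q`
and `b`, `d` have bidegree `t`. -/
def HasBidegree (g : R) (x y : ℕ) : Prop :=
  g ≠ 0 ∧ IsWeightedHomogeneous (![(1, 0), (0, 1), (1, 0), (0, 1)] : Fin 4 → ℕ × ℕ) g (x, y)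

/-- The monomial multiples of the generators that form the basis. -/
def basisA (d₁ d₂ : ℕ) : Set R :=
  {f | ∃ j < d₁, ∃ i, 1 ≤ i ∧ i ≤ d₁ - j ∧ ∃ α γ : ℕ, f = a ^ α * c ^ γ * A d₁ d₂ i j}

def basisB (d₁ d₂ : ℕ) : Set R :=
  {f | ∃ j < d₁, ∃ i, 1 ≤ i ∧ i ≤ d₁ - j ∧
    ∃ α β δ : ℕ, f = a ^ α * b ^ β * d ^ δ * B d₁ d₂ i j}

def basisC (d₁ d₂ : ℕ) : Set R :=
  {f | ∃ j < d₁, ∃ i, 1 ≤ i ∧ i ≤ d₂ - j ∧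
    ∃ α γ δ : ℕ, f = a ^ α * c ^ γ * d ^ δ * C d₁ d₂ i j}

def basisD (d₁ d₂ : ℕ) : Set R :=
  {f | ∃ j < d₁, ∃ α δ : ℕ, f = a ^ α * d ^ δ * D d₁ d₂ j}

/-- The basis elements with `j = d₁`. -/
def basisTop (d₁ d₂ : ℕ) : Set R :=
  {f | ∃ α β γ δ : ℕ, d₂ - d₁ ≤ γ + δ ∧
    f = a ^ α * b ^ β * c ^ γ * d ^ δ * (a * d - b * c) ^ d₁}

/-- The basis, as a set of polynomials: an element that arises in several ways
(for instance `b * B i j = a * B (i + 1) j`) occurs once. -/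
def basisSet (d₁ d₂ : ℕ) : Set R :=
  basisA d₁ d₂ ∪ basisB d₁ d₂ ∪ basisC d₁ d₂ ∪ basisD d₁ d₂ ∪ basisTop d₁ d₂

end TripleIdeal

end

/-! The proof is an induction on `d₁`, lowering `d₁` and `d₂` together and peeling off one factor of
`det` at a time. Geometrically, `J` is attached to three lines of one ruling of the quadric `ad =
bc`. The map `segre`, with `X 0, X 1, X 2, X 3` in the roles of `s, t, u, v`, parametrizes that
quadric and has kernel `(det)`; on it the three lines become `s = 0`, `t = 0` and `s = t`.

An element of `J m n` therefore has an image divisible by `lines m n` (`lines_dvd_segre`). The image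
is also balanced: its degree in `s, t` equals its degree in `u, v`. So it is a combination of
products of `lines m n` with monomials that restore the balance, and `lowest` provides one preimage
in `J` for each such monomial (`segre_lowest`, `segre_mem_span`). What remains of the element lies
in `(det) ∩ J`. Cancelling `det` lowers all three exponents by exactly one (`mem_J_of_det_mul_mem`),
so `J` at level `(d₁ + 1, d₂ + 1)` is the direct sum of the span of `lowest` and `det` times `J` at
level `(d₁, d₂)`.

The proposed basis obeys the same recursion (`basisSet_succ`): its `j = 0` part is `lowest`, and
raising `j` by one multiplies by `det`. The induction ends at `d₁ = 0`, where `J` is the monomial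
ideal `(c, d) ^ d₂`. Generation of `J` follows, since each basis element is a multiple of a
generator. -/

namespace TripleIdeal

noncomputable section

/-- The determinant `ad - bc`. -/
abbrev det : R := a * d - b * c

/-! ### Bidegrees -/

theorem HasBidegree.mul {f g : R} {x y x' y' : ℕ} (hf : HasBidegree f x y)
    (hg : HasBidegree g x' y') : HasBidegree (f * g) (x + x') (y + y') :=
  ⟨mul_ne_zero hf.1 hg.1, hf.2.mul hg.2⟩

theorem HasBidegree.pow {f : R} {x y : ℕ} (hf : HasBidegree f x y) (n : ℕ) :
    HasBidegree (f ^ n) (n * x) (n * y) := by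
  refine ⟨pow_ne_zero _ hf.1, ?_⟩
  simpa using hf.2.pow n

theorem HasBidegree.unique {f : R} {x y x' y' : ℕ} (hf : HasBidegree f x y)
    (hf' : HasBidegree f x' y') : x = x' ∧ y = y' := by
  simpa using hf.2.inj_right hf.1 hf'.2

theorem HasBidegree.unique_of_eq {f g : R} {x y x' y' : ℕ} (hf : HasBidegree f x y)
    (hg : HasBidegree g x' y') (e : f = g) : x = x' ∧ y = y' := hf.unique (e ▸ hg)

theorem hasBidegree_a : HasBidegree a 1 0 :=
  ⟨X_ne_zero 0, isWeightedHomogeneous_X ℂ _ 0⟩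

theorem hasBidegree_b : HasBidegree b 0 1 :=
  ⟨X_ne_zero 1, isWeightedHomogeneous_X ℂ _ 1⟩

theorem hasBidegree_c : HasBidegree c 1 0 :=
  ⟨X_ne_zero 2, isWeightedHomogeneous_X ℂ _ 2⟩

theorem hasBidegree_d : HasBidegree d 0 1 :=
  ⟨X_ne_zero 3, isWeightedHomogeneous_X ℂ _ 3⟩

theorem HasBidegree.sub {f g : R} {x y : ℕ} (hf : HasBidegree f x y) (hg : HasBidegree g x y)
    (h : f - g ≠ 0) : HasBidegree (f - g) x y :=
  ⟨h, (weightedHomogeneousSubmodule ℂ _ _).sub_mem hf.2 hg.2⟩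

theorem hasBidegree_a_sub_c : HasBidegree (a - c) 1 0 := by
  refine hasBidegree_a.sub hasBidegree_c fun h => ?_
  simpa [a, c] using congrArg (eval ![1, 0, 0, 0]) h

theorem hasBidegree_b_sub_d : HasBidegree (b - d) 0 1 := by
  refine hasBidegree_b.sub hasBidegree_d fun h => ?_
  simpa [b, d] using congrArg (eval ![0, 1, 0, 0]) h

theorem det_ne_zero : det ≠ 0 := fun h => by
  simpa [a, b, c, d] using congrArg (eval ![1, 0, 0, 1]) h

theorem hasBidegree_det : HasBidegree det 1 1 :=
  (hasBidegree_a.mul hasBidegree_d).sub (hasBidegree_b.mul hasBidegree_c) det_ne_zero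

theorem HasBidegree.cast {f : R} {x y x' y' : ℕ} (hf : HasBidegree f x y) (hx : x = x')
    (hy : y = y') : HasBidegree f x' y' := hx ▸ hy ▸ hf

section Families

variable {d₁ d₂ i j : ℕ}

theorem hasBidegree_A (h : d₁ ≤ d₂) (hj : j ≤ d₁) (hi : i ≤ d₁ - j) :
    HasBidegree (A d₁ d₂ i j) (d₁ + d₂ - j + i) (d₁ - i) :=
  (((((hasBidegree_a.pow _).mul (hasBidegree_c.pow _)).mul (hasBidegree_a_sub_c.pow _)).mul
    (hasBidegree_b_sub_d.pow _)).mul (hasBidegree_det.pow _)).cast (by omega) (by omega)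

theorem hasBidegree_B (h : d₁ ≤ d₂) (hj : j ≤ d₁) (hi : i ≤ d₁ - j) :
    HasBidegree (B d₁ d₂ i j) (d₁ - i) (d₁ + d₂ - j + i) :=
  (((((hasBidegree_a.pow _).mul (hasBidegree_b.pow _)).mul (hasBidegree_d.pow _)).mul
    (hasBidegree_b_sub_d.pow _)).mul (hasBidegree_det.pow _)).cast (by omega) (by omega)

theorem hasBidegree_C (h : d₁ ≤ d₂) (hj : j ≤ d₁) (hi : i ≤ d₂ - j) :
    HasBidegree (C d₁ d₂ i j) (d₁ + i) (d₁ + d₂ - j - i) :=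
  (((((hasBidegree_a.pow _).mul (hasBidegree_c.pow _)).mul (hasBidegree_d.pow _)).mul
    (hasBidegree_b_sub_d.pow _)).mul (hasBidegree_det.pow _)).cast (by omega) (by omega)

theorem hasBidegree_D (h : d₁ ≤ d₂) (hj : j ≤ d₁) :
    HasBidegree (D d₁ d₂ j) d₁ (d₁ + d₂ - j) :=
  ((((hasBidegree_a.pow _).mul (hasBidegree_d.pow _)).mul
    (hasBidegree_b_sub_d.pow _)).mul (hasBidegree_det.pow _)).cast (by omega) (by omega)

end Families

/-! ### Counting the generators: distinct bidegrees separate them. -/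

theorem ncard_setOf_eq (F : ℕ → R) (n : ℕ)
    (hF : ∀ i i', 1 ≤ i → i ≤ n → 1 ≤ i' → i' ≤ n → F i = F i' → i = i') :
    {g | ∃ i, 1 ≤ i ∧ i ≤ n ∧ g = F i}.ncard = n := by
  have : {g | ∃ i, 1 ≤ i ∧ i ≤ n ∧ g = F i} = F '' (Finset.Icc 1 n : Finset ℕ) := by
    ext g
    simp only [Set.mem_ofPred_eq, Set.mem_image, Finset.mem_coe, Finset.mem_Icc]
    constructor
    · rintro ⟨i, h1, h2, rfl⟩
      exact ⟨i, ⟨h1, h2⟩, rfl⟩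
    · rintro ⟨i, ⟨h1, h2⟩, rfl⟩
      exact ⟨i, h1, h2, rfl⟩
  rw [this, Set.InjOn.ncard_image, Set.ncard_coe_finset, Nat.card_Icc, Nat.add_sub_cancel]
  intro i hi i' hi' e
  simp only [Finset.mem_coe, Finset.mem_Icc] at hi hi'
  exact hF i i' hi.1 hi.2 hi'.1 hi'.2 e

section Counting

variable {d₁ d₂ j : ℕ}

theorem ncard_rowA (h : d₁ ≤ d₂) (hj : j ≤ d₁) : (rowA d₁ d₂ j).ncard = d₁ - j := by
  refine ncard_setOf_eq (fun i => A d₁ d₂ i j) _ fun i i' _ h2 _ h4 e => ?_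
  have := (hasBidegree_A h hj h2).unique_of_eq (hasBidegree_A h hj h4) e
  omega

theorem ncard_rowB (h : d₁ ≤ d₂) (hj : j ≤ d₁) : (rowB d₁ d₂ j).ncard = d₁ - j := by
  refine ncard_setOf_eq (fun i => B d₁ d₂ i j) _ fun i i' _ h2 _ h4 e => ?_
  have := (hasBidegree_B h hj h2).unique_of_eq (hasBidegree_B h hj h4) e
  omega

theorem ncard_rowC (h : d₁ ≤ d₂) (hj : j ≤ d₁) : (rowC d₁ d₂ j).ncard = d₂ - j := by
  refine ncard_setOf_eq (fun i => C d₁ d₂ i j) _ fun i i' _ h2 _ h4 e => ?_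
  have := (hasBidegree_C h hj h2).unique_of_eq (hasBidegree_C h hj h4) e
  omega

theorem ncard_famD (h : d₁ ≤ d₂) : (famD d₁ d₂).ncard = d₁ + 1 := by
  -- The index is shifted by one because `ncard_setOf_eq` counts from `1`, while `D` starts at `j =
  -- 0`.
  have : famD d₁ d₂ = {g | ∃ i, 1 ≤ i ∧ i ≤ d₁ + 1 ∧ g = D d₁ d₂ (i - 1)} := by
    ext g
    constructor
    · rintro ⟨j, hj, rfl⟩
      exact ⟨j + 1, by omega, by omega, rfl⟩
    · rintro ⟨i, h1, h2, rfl⟩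
      exact ⟨i - 1, by omega, rfl⟩
  rw [this]
  refine ncard_setOf_eq (fun i => D d₁ d₂ (i - 1)) _ fun i i' h1 h2 h3 h4 e => ?_
  have := (hasBidegree_D (j := i - 1) h (by omega)).unique_of_eq
    (hasBidegree_D (j := i' - 1) h (by omega)) e
  omega

end Counting

/-- Each family confines its bidegrees to one of four pairwise disjoint regions, which gives the
converse implications. The inequalities `d₁ < x` for `A` and `d₁ ≤ y` for `B` and `D`, absent from
the conclusion, are what makes the regions disjoint. -/
theorem mem_fam_iff_bidegree {d₁ d₂ : ℕ} (h : d₁ ≤ d₂) {g : R} (hg : g ∈ generators d₁ d₂)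
    {x y : ℕ} (hxy : HasBidegree g x y) :
    (g ∈ famA d₁ d₂ ↔ y < d₁) ∧ (g ∈ famB d₁ d₂ ↔ x < d₁) ∧
      (g ∈ famC d₁ d₂ ↔ d₁ < x ∧ d₁ ≤ y) ∧ (g ∈ famD d₁ d₂ ↔ x = d₁) := by
  have hA : g ∈ famA d₁ d₂ → y < d₁ ∧ d₁ < x := by
    rintro ⟨j, hj, i, h1, h2, rfl⟩
    have := hxy.unique (hasBidegree_A h hj h2)
    omega
  have hB : g ∈ famB d₁ d₂ → x < d₁ ∧ d₁ ≤ y := by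
    rintro ⟨j, hj, i, h1, h2, rfl⟩
    have := hxy.unique (hasBidegree_B h hj h2)
    omega
  have hC : g ∈ famC d₁ d₂ → d₁ < x ∧ d₁ ≤ y := by
    rintro ⟨j, hj, i, h1, h2, rfl⟩
    have := hxy.unique (hasBidegree_C h hj h2)
    omega
  have hD : g ∈ famD d₁ d₂ → x = d₁ ∧ d₁ ≤ y := by
    rintro ⟨j, hj, rfl⟩
    have := hxy.unique (hasBidegree_D h hj)
    omega
  have key : g ∈ famA d₁ d₂ ∨ g ∈ famB d₁ d₂ ∨ g ∈ famC d₁ d₂ ∨ g ∈ famD d₁ d₂ := by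
    simpa [generators, or_assoc] using hg
  rcases key with k | k | k | k
  · have hk := hA k
    exact ⟨⟨fun H => (hA H).1, fun H => k⟩,
      ⟨fun H => (hB H).1, fun H => by exfalso; omega⟩,
      ⟨fun H => hC H, fun H => by exfalso; omega⟩,
      ⟨fun H => (hD H).1, fun H => by exfalso; omega⟩⟩
  · have hk := hB k
    exact ⟨⟨fun H => (hA H).1, fun H => by exfalso; omega⟩,
      ⟨fun H => (hB H).1, fun H => k⟩,
      ⟨fun H => hC H, fun H => by exfalso; omega⟩,
      ⟨fun H => (hD H).1, fun H => by exfalso; omega⟩⟩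
  · have hk := hC k
    exact ⟨⟨fun H => (hA H).1, fun H => by exfalso; omega⟩,
      ⟨fun H => (hB H).1, fun H => by exfalso; omega⟩,
      ⟨fun H => hC H, fun H => k⟩,
      ⟨fun H => (hD H).1, fun H => by exfalso; omega⟩⟩
  · have hk := hD k
    exact ⟨⟨fun H => (hA H).1, fun H => by exfalso; omega⟩,
      ⟨fun H => (hB H).1, fun H => by exfalso; omega⟩,
      ⟨fun H => hC H, fun H => by exfalso; omega⟩,
      ⟨fun H => (hD H).1, fun H => k⟩⟩

/-! ### The generators lie in `J` -/

theorem det_mem_span_ab : det ∈ Ideal.span {a, b} :=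
  Ideal.mem_span_pair.2 ⟨d, -c, by rw [det]; ring⟩

theorem det_mem_span_cd : det ∈ Ideal.span {c, d} :=
  Ideal.mem_span_pair.2 ⟨-b, a, by rw [det]; ring⟩

theorem det_mem_span_sub : det ∈ Ideal.span {a - c, b - d} :=
  Ideal.mem_span_pair.2 ⟨b, -a, by rw [det]; ring⟩

theorem pow_mul_pow_mul_pow_mem {I : Ideal R} {x y z : R} (hx : x ∈ I) (hy : y ∈ I) (hz : z ∈ I)
    {k l j n : ℕ} (r : R) (h : n ≤ k + l + j) : x ^ k * y ^ l * z ^ j * r ∈ I ^ n := by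
  refine Ideal.mul_mem_right _ _ (Ideal.pow_le_pow_right h ?_)
  rw [pow_add, pow_add]
  exact Ideal.mul_mem_mul (Ideal.mul_mem_mul (Ideal.pow_mem_pow hx k) (Ideal.pow_mem_pow hy l))
    (Ideal.pow_mem_pow hz j)

section Membership

variable {p q : R}

theorem left_mem_span_pair : p ∈ Ideal.span {p, q} := Ideal.subset_span (by simp)

theorem right_mem_span_pair : q ∈ Ideal.span {p, q} := Ideal.subset_span (by simp)

end Membership

/-- Since `det` lies in all three linear ideals, the factor `det ^ j` counts towards each of the
three required powers. Three factorizations of the same polynomial exhibit the remaining factors. -/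
theorem mem_J_of_eq {d₁ d₂ : ℕ} (f : R) {k l j k' l' k'' l'' : ℕ} (r r' r'' : R)
    (h : f = a ^ k * b ^ l * det ^ j * r) (hd : d₁ ≤ k + l + j)
    (h' : f = c ^ k' * d ^ l' * det ^ j * r') (hd' : d₂ ≤ k' + l' + j)
    (h'' : f = (a - c) ^ k'' * (b - d) ^ l'' * det ^ j * r'') (hd'' : d₁ ≤ k'' + l'' + j) :
    f ∈ J d₁ d₂ := by
  refine ⟨⟨?_, ?_⟩, ?_⟩
  · rw [h]
    exact pow_mul_pow_mul_pow_mem left_mem_span_pair right_mem_span_pair det_mem_span_ab r hd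
  · rw [h']
    exact pow_mul_pow_mul_pow_mem left_mem_span_pair right_mem_span_pair det_mem_span_cd r' hd'
  · rw [h'']
    exact pow_mul_pow_mul_pow_mem left_mem_span_pair right_mem_span_pair det_mem_span_sub r'' hd''

theorem generators_subset_J {d₁ d₂ : ℕ} (h : d₁ ≤ d₂) : generators d₁ d₂ ⊆ J d₁ d₂ := by
  rintro g (((⟨j, hj, i, h1, h2, rfl⟩ | ⟨j, hj, i, h1, h2, rfl⟩) | ⟨j, hj, i, h1, h2, rfl⟩) |
    ⟨j, hj, rfl⟩)
  · refine mem_J_of_eq (k := d₁ - j) (l := 0) (k' := d₂ - j) (l' := 0) (j := j)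
      (k'' := i) (l'' := d₁ - j - i) _
      (c ^ (d₂ - j) * (a - c) ^ i * (b - d) ^ (d₁ - j - i))
      (a ^ (d₁ - j) * (a - c) ^ i * (b - d) ^ (d₁ - j - i))
      (a ^ (d₁ - j) * c ^ (d₂ - j)) ?_ ?_ ?_ ?_ ?_ ?_ <;> first | omega | (rw [A, det]; ring)
  · refine mem_J_of_eq (k := d₁ - j - i) (l := i) (k' := 0) (l' := d₂ - j) (j := j)
      (k'' := 0) (l'' := d₁ - j) _
      (d ^ (d₂ - j) * (b - d) ^ (d₁ - j))
      (a ^ (d₁ - j - i) * b ^ i * (b - d) ^ (d₁ - j))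
      (a ^ (d₁ - j - i) * b ^ i * d ^ (d₂ - j)) ?_ ?_ ?_ ?_ ?_ ?_ <;>
      first | omega | (rw [B, det]; ring)
  · refine mem_J_of_eq (k := d₁ - j) (l := 0) (k' := i) (l' := d₂ - j - i) (j := j)
      (k'' := 0) (l'' := d₁ - j) _
      (c ^ i * d ^ (d₂ - j - i) * (b - d) ^ (d₁ - j))
      (a ^ (d₁ - j) * (b - d) ^ (d₁ - j))
      (a ^ (d₁ - j) * c ^ i * d ^ (d₂ - j - i)) ?_ ?_ ?_ ?_ ?_ ?_ <;>
      first | omega | (rw [C, det]; ring)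
  · refine mem_J_of_eq (k := d₁ - j) (l := 0) (k' := 0) (l' := d₂ - j) (j := j)
      (k'' := 0) (l'' := d₁ - j) _
      (d ^ (d₂ - j) * (b - d) ^ (d₁ - j))
      (a ^ (d₁ - j) * (b - d) ^ (d₁ - j))
      (a ^ (d₁ - j) * d ^ (d₂ - j)) ?_ ?_ ?_ ?_ ?_ ?_ <;>
      first | omega | (rw [D, det]; ring)

theorem basisSet_subset_span_generators (d₁ d₂ : ℕ) :
    basisSet d₁ d₂ ⊆ Ideal.span (generators d₁ d₂) := by
  rintro f ((((⟨j, hj, i, h1, h2, α, γ, rfl⟩ | ⟨j, hj, i, h1, h2, α, β, δ, rfl⟩) |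
    ⟨j, hj, i, h1, h2, α, γ, δ, rfl⟩) | ⟨j, hj, α, δ, rfl⟩) | ⟨α, β, γ, δ, hn, rfl⟩)
  · exact Ideal.mul_mem_left _ _ <| Ideal.subset_span <|
      .inl <| .inl <| .inl ⟨j, hj.le, i, h1, h2, rfl⟩
  · exact Ideal.mul_mem_left _ _ <| Ideal.subset_span <|
      .inl <| .inl <| .inr ⟨j, hj.le, i, h1, h2, rfl⟩
  · exact Ideal.mul_mem_left _ _ <| Ideal.subset_span <|
      .inl <| .inr ⟨j, hj.le, i, h1, h2, rfl⟩
  · exact Ideal.mul_mem_left _ _ <| Ideal.subset_span <| .inr ⟨j, hj.le, rfl⟩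
  -- From `c ^ γ * d ^ δ` a monomial of degree exactly `d₂ - d₁` is split off, taking as many
  -- factors `c` as possible. Times `det ^ d₁` it is `C d₁ d₂ i d₁`, or `D d₁ d₂ d₁` when `i = 0`.
  · obtain ⟨i, γ', δ', rfl, hi, rfl⟩ :
        ∃ i γ' δ', γ = γ' + i ∧ i ≤ d₂ - d₁ ∧ δ = δ' + (d₂ - d₁ - i) :=
      ⟨min γ (d₂ - d₁), γ - min γ (d₂ - d₁), δ - (d₂ - d₁ - min γ (d₂ - d₁)),
        by omega, by omega, by omega⟩
    have hC : C d₁ d₂ i d₁ ∈ Ideal.span (generators d₁ d₂) := by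
      rcases Nat.eq_zero_or_pos i with rfl | h0
      · exact Ideal.subset_span <| .inr ⟨d₁, le_rfl, by simp [C, D]⟩
      · exact Ideal.subset_span <| .inl <| .inr ⟨d₁, le_rfl, i, h0, hi, rfl⟩
    rw [SetLike.mem_coe]
    convert Ideal.mul_mem_left _ (a ^ α * b ^ β * c ^ γ' * d ^ δ') hC using 1
    rw [C, Nat.sub_self]
    ring

/-! ### Division by the determinant -/

/-- Let `τ` be the polynomial variable. The map `ψ` sends `I ^ (m + 1)` into multiples of `τ ^ (m +
1)`, and `det` contributes only one factor `τ`, so `ψ f` is divisible by `τ ^ m`. Its coefficient at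
`τ ^ k` lies in `I ^ k` by the Rees algebra condition, and setting `τ = 1` recovers `f` as the sum
of the coefficients with `k ≥ m`. -/
theorem det_mul_mem_pow {p q : R} (ψ : R →ₐ[ℂ] Polynomial R)
    (hrees : ∀ i, ψ (X i) ∈ reesAlgebra (Ideal.span {p, q}))
    (heval : ∀ i, Polynomial.eval 1 (ψ (X i)) = X i)
    (hp : ψ p = Polynomial.X * Polynomial.C p) (hq : ψ q = Polynomial.X * Polynomial.C q)
    (hdet : ψ det = Polynomial.X * Polynomial.C det) {m : ℕ} {f : R}
    (hf : det * f ∈ Ideal.span {p, q} ^ (m + 1)) : f ∈ Ideal.span {p, q} ^ m := by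
  set I := Ideal.span {p, q} with hI
  have mem_rees : ∀ g, ψ g ∈ reesAlgebra I := fun g => by
    induction g using MvPolynomial.induction_on with
    | C r =>
      rw [← MvPolynomial.algebraMap_eq, AlgHom.commutes]
      exact (reesAlgebra I).algebraMap_mem (algebraMap ℂ R r)
    | add g g' h h' => rw [map_add]; exact add_mem h h'
    | mul_X g i h => rw [map_mul]; exact mul_mem h (hrees i)
  have eval_one : ∀ g, Polynomial.eval 1 (ψ g) = g := fun g => by
    induction g using MvPolynomial.induction_on with
    | C r =>
      rw [← MvPolynomial.algebraMap_eq, AlgHom.commutes,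
        IsScalarTower.algebraMap_apply ℂ R (Polynomial R), Polynomial.algebraMap_eq,
        Polynomial.eval_C]
    | add g g' h h' => rw [map_add, Polynomial.eval_add, h, h']
    | mul_X g i h => rw [map_mul, Polynomial.eval_mul, h, heval]
  have dvd_of_mem : (Polynomial.X : Polynomial R) ^ (m + 1) ∣ ψ (det * f) := by
    have hle : (I ^ (m + 1)).map ψ ≤ Ideal.span {(Polynomial.X : Polynomial R) ^ (m + 1)} := by
      rw [Ideal.map_pow, ← Ideal.span_singleton_pow]
      refine Ideal.pow_right_mono ?_ _
      rw [hI, Ideal.map_span, Ideal.span_le, Set.image_pair, hp, hq]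
      rintro _ (rfl | rfl) <;> exact Ideal.mem_span_singleton.2 (dvd_mul_right _ _)
    exact Ideal.mem_span_singleton.1 (hle (Ideal.mem_map_of_mem _ hf))
  have coeff_eq_zero : ∀ k < m, (ψ f).coeff k = 0 := fun k hk => by
    rw [map_mul, hdet, pow_succ', mul_assoc,
      mul_dvd_mul_iff_left Polynomial.X_ne_zero, Polynomial.X_pow_dvd_iff] at dvd_of_mem
    have := dvd_of_mem k hk
    rw [Polynomial.coeff_C_mul] at this
    exact (mul_eq_zero.1 this).resolve_left det_ne_zero
  rw [← eval_one f, Polynomial.eval_eq_sum_range]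
  refine sum_mem fun k _ => ?_
  rw [one_pow, mul_one]
  rcases lt_or_ge k m with hk | hk
  · rw [coeff_eq_zero k hk]; exact zero_mem _
  · exact Ideal.pow_le_pow_right hk ((mem_reesAlgebra_iff I _).1 (mem_rees f) k)

theorem C_add_X_mul_C_mem_reesAlgebra {I : Ideal R} (r : R) {s : R} (hs : s ∈ I) :
    Polynomial.C r + Polynomial.X * Polynomial.C s ∈ reesAlgebra I := by
  refine add_mem ((reesAlgebra I).algebraMap_mem r) ?_
  rw [Polynomial.X_mul_C, ← pow_one Polynomial.X, Polynomial.C_mul_X_pow_eq_monomial]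
  exact reesAlgebra.monomial_mem.2 (by simpa using hs)

/-- The substitution `X i ↦ u i + τ v i`. -/
def deform (u v : Fin 4 → R) : R →ₐ[ℂ] Polynomial R :=
  aeval fun i => Polynomial.C (u i) + Polynomial.X * Polynomial.C (v i)

theorem deform_X (u v : Fin 4 → R) (i : Fin 4) :
    deform u v (X i) = Polynomial.C (u i) + Polynomial.X * Polynomial.C (v i) := by
  simp [deform]

theorem det_mul_mem_pow_of_deform {p q : R} (u v : Fin 4 → R)
    (huv : ∀ i, u i + v i = X i) (hv : ∀ i, v i ∈ Ideal.span {p, q})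
    (hp : deform u v p = Polynomial.X * Polynomial.C p)
    (hq : deform u v q = Polynomial.X * Polynomial.C q)
    (hdet : deform u v det = Polynomial.X * Polynomial.C det) {m : ℕ} {f : R}
    (hf : det * f ∈ Ideal.span {p, q} ^ (m + 1)) : f ∈ Ideal.span {p, q} ^ m := by
  refine det_mul_mem_pow (deform u v) (fun i => ?_) (fun i => ?_) hp hq hdet hf
  · rw [deform_X]; exact C_add_X_mul_C_mem_reesAlgebra _ (hv i)
  · simp [deform_X, huv]

/-- For each of the three ideals, the deformation contracts the plane's normal coordinates by `τ`
and fixes complementary ones. As `det` is linear in the normal coordinates, it scales by exactly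
`τ`. -/
theorem mem_J_of_det_mul_mem {d₁ d₂ : ℕ} {f : R} (hf : det * f ∈ J (d₁ + 1) (d₂ + 1)) :
    f ∈ J d₁ d₂ := by
  obtain ⟨⟨h1, h2⟩, h3⟩ := hf
  refine ⟨⟨?_, ?_⟩, ?_⟩
  · refine det_mul_mem_pow_of_deform ![0, 0, c, d] ![a, b, 0, 0] ?_ ?_ ?_ ?_ ?_ h1
    · intro i; fin_cases i <;> simp [a, b, c, d]
    · intro i
      fin_cases i <;> simp [left_mem_span_pair, right_mem_span_pair]
    · simp [a, deform_X]
    · simp [b, deform_X]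
    · simp [a, b, c, d, deform_X]; ring
  · refine det_mul_mem_pow_of_deform ![a, b, 0, 0] ![0, 0, c, d] ?_ ?_ ?_ ?_ ?_ h2
    · intro i; fin_cases i <;> simp [a, b, c, d]
    · intro i
      fin_cases i <;> simp [left_mem_span_pair, right_mem_span_pair]
    · simp [c, deform_X]
    · simp [d, deform_X]
    · simp [a, b, c, d, deform_X]; ring
  -- Here `a` and `b` stay fixed while `c ↦ a + τ (c - a)` and `d ↦ b + τ (d - b)`.
  · refine det_mul_mem_pow_of_deform ![a, b, a, b] ![0, 0, c - a, d - b] ?_ ?_ ?_ ?_ ?_ h3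
    · intro i; fin_cases i <;> simp [a, b, c, d]
    · have hc : c - a ∈ Ideal.span {a - c, b - d} :=
        neg_sub a c ▸ neg_mem left_mem_span_pair
      have hd : d - b ∈ Ideal.span {a - c, b - d} :=
        neg_sub b d ▸ neg_mem right_mem_span_pair
      intro i
      fin_cases i <;> simp [hc, hd]
    · simp [a, c, deform_X]; ring
    · simp [b, d, deform_X]; ring
    · simp [a, b, c, d, deform_X]; ring

/-! ### Monomials -/

/-- The exponent vector `(x, y, k, l)`. -/
def expo (x y k l : ℕ) : Fin 4 →₀ ℕ := Finsupp.equivFunOnFinite.symm ![x, y, k, l]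

@[simp] theorem expo_zero (x y k l : ℕ) : expo x y k l 0 = x := rfl
@[simp] theorem expo_one (x y k l : ℕ) : expo x y k l 1 = y := rfl
@[simp] theorem expo_two (x y k l : ℕ) : expo x y k l 2 = k := rfl
@[simp] theorem expo_three (x y k l : ℕ) : expo x y k l 3 = l := rfl

theorem monomial_eq_prod (e : Fin 4 →₀ ℕ) :
    (monomial e 1 : R) = X 0 ^ e 0 * X 1 ^ e 1 * X 2 ^ e 2 * X 3 ^ e 3 := by
  rw [monomial_eq, Finsupp.prod_fintype _ _ (fun _ => pow_zero _), Fin.prod_univ_four,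
    MvPolynomial.C_1, one_mul]

theorem prod_eq_monomial (x y k l : ℕ) :
    a ^ x * b ^ y * c ^ k * d ^ l = monomial (expo x y k l) 1 := by
  rw [monomial_eq_prod]; rfl

theorem linearIndependent_monomial : LinearIndependent ℂ fun e : Fin 4 →₀ ℕ => (monomial e 1 : R) :=
  (basisMonomials (Fin 4) ℂ).linearIndependent

theorem mem_of_monomial_mem {W : Submodule ℂ R} (h : ∀ e, monomial e 1 ∈ W) (f : R) : f ∈ W := by
  induction f using MvPolynomial.induction_on' with
  | monomial e r =>
    rw [← mul_one r, ← smul_eq_mul, ← smul_monomial]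
    exact W.smul_mem _ (h e)
  | add f g hf hg => exact W.add_mem hf hg

/-! ### The parametrization of the cone `ad = bc` -/

/-- The substitution `a = su`, `b = sv`, `c = tu`, `d = tv`. -/
def segre : R →ₐ[ℂ] R := aeval ![X 0 * X 2, X 0 * X 3, X 1 * X 2, X 1 * X 3]

@[simp] theorem segre_a : segre a = X 0 * X 2 := by simp [segre, a]
@[simp] theorem segre_b : segre b = X 0 * X 3 := by simp [segre, b]
@[simp] theorem segre_c : segre c = X 1 * X 2 := by simp [segre, c]
@[simp] theorem segre_d : segre d = X 1 * X 3 := by simp [segre, d]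

theorem segre_det : segre det = 0 := by simp [det]; ring

theorem segre_monomial (e : Fin 4 →₀ ℕ) :
    segre (monomial e 1) = monomial (expo (e 0 + e 1) (e 2 + e 3) (e 0 + e 2) (e 1 + e 3)) 1 := by
  have : (monomial e 1 : R) = a ^ e 0 * b ^ e 1 * c ^ e 2 * d ^ e 3 := monomial_eq_prod e
  rw [this, monomial_eq_prod]
  simp
  ring

/-- The exponents of the monomials that are not divisible by `ad`. -/
abbrev Reduced : Type := {e : Fin 4 →₀ ℕ // e 0 = 0 ∨ e 3 = 0}

/-- Two monomials have the same image exactly when their exponents differ by a multiple of `(1, -1,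
-1, 1)`. Requiring the exponent of `a` or of `d` to vanish selects one exponent vector in each such
class. -/
theorem linearIndependent_segre_reduced :
    LinearIndependent ℂ (segre.toLinearMap ∘ fun e : Reduced => (monomial e.1 1 : R)) := by
  have := linearIndependent_monomial.comp
    (fun e : Reduced => expo (e.1 0 + e.1 1) (e.1 2 + e.1 3) (e.1 0 + e.1 2) (e.1 1 + e.1 3)) <| by
      rintro ⟨e, he⟩ ⟨e', he'⟩ h
      have h0 := DFunLike.congr_fun h 0
      have h1 := DFunLike.congr_fun h 1
      have h2 := DFunLike.congr_fun h 2
      have h3 := DFunLike.congr_fun h 3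
      simp only [expo_zero, expo_one, expo_two, expo_three] at h0 h1 h2 h3
      refine Subtype.ext (Finsupp.ext fun i => ?_)
      fin_cases i <;> simp only [Fin.zero_eta, Fin.mk_one, Fin.reduceFinMk] <;> omega
  convert this using 1
  ext1 e
  exact segre_monomial e.1

/-- Rewriting `ad` as `bc + det` lowers the exponent of `a`. -/
theorem reduce_mem (x y k l : ℕ) : a ^ x * b ^ y * c ^ k * d ^ l ∈
    Submodule.span ℂ (Set.range fun e : Reduced => (monomial e.1 1 : R)) ⊔
      (Ideal.span {det}).restrictScalars ℂ := by
  induction x generalizing y k l with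
  | zero =>
    rw [prod_eq_monomial]
    exact Submodule.mem_sup_left (Submodule.subset_span ⟨⟨expo 0 y k l, .inl rfl⟩, rfl⟩)
  | succ x ih =>
    cases l with
    | zero =>
      rw [prod_eq_monomial]
      exact Submodule.mem_sup_left (Submodule.subset_span ⟨⟨expo _ y k 0, .inr rfl⟩, rfl⟩)
    | succ l =>
      have : a ^ (x + 1) * b ^ y * c ^ k * d ^ (l + 1) =
          a ^ x * b ^ (y + 1) * c ^ (k + 1) * d ^ l + a ^ x * b ^ y * c ^ k * d ^ l * det := by
        rw [det]; ring
      rw [this]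
      exact add_mem (ih _ _ _)
        (Submodule.mem_sup_right (Ideal.mul_mem_left _ _ (Ideal.mem_span_singleton_self _)))

/-- Modulo `det`, every polynomial is a combination of reduced monomials, and `segre` is injective
on those combinations. -/
theorem det_dvd_of_segre_eq_zero {f : R} (hf : segre f = 0) : det ∣ f := by
  obtain ⟨r, hr, g, hg, rfl⟩ := Submodule.mem_sup.1 <| mem_of_monomial_mem
    (fun e => monomial_eq_prod e ▸ reduce_mem (e 0) (e 1) (e 2) (e 3)) f
  obtain ⟨g, rfl⟩ := Ideal.mem_span_singleton.1 hg
  have hr0 : r = 0 := by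
    refine Submodule.disjoint_def.1
      (Submodule.range_ker_disjoint linearIndependent_segre_reduced) r hr ?_
    simpa [segre_det] using hf
  rw [hr0, zero_add]
  exact dvd_mul_right _ _

/-! ### The basis elements of level `j = 0` -/

/-- The equation `s ^ m t ^ n (s - t) ^ m` cutting out the three lines. -/
def lines (m n : ℕ) : R := X 0 ^ m * X 1 ^ n * (X 0 - X 1) ^ m

/-- The exponents of the monomials which, multiplied by `lines m n`, become balanced. -/
abbrev Level (m n : ℕ) : Type :=
  {e : Fin 4 →₀ ℕ // e 2 + e 3 = e 0 + e 1 + (2 * m + n)}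

/-- The element of `J` whose image under `segre` is `lines m n * s ^ x * t ^ y * u ^ k * v ^ l`,
where `k + l = x + y + 2 * m + n`. -/
def lift (m n x y l : ℕ) : R :=
  if l < m then a ^ (m + x) * c ^ (n + y) * (a - c) ^ (m - l) * (b - d) ^ l
  else if l ≤ m + n + y then a ^ (m + x) * c ^ (m + n + y - l) * d ^ (l - m) * (b - d) ^ m
  else a ^ (2 * m + n + x + y - l) * b ^ (l - (m + n + y)) * d ^ (n + y) * (b - d) ^ m

/-- The exponents `k` and `l` of `X 2` and `X 3` are the `q`-degree and `t`-degree of the lift. The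
size of `l` selects the branch: shape `A` for `l < m`, shape `C` up to `m + n + y`, with shape `D`
at that endpoint, and shape `B` beyond it. The hypothesis makes the truncated subtractions exact. -/
theorem segre_lift {m n x y k l : ℕ} (h : k + l = x + y + (2 * m + n)) :
    segre (lift m n x y l) = lines m n * (X 0 ^ x * X 1 ^ y * X 2 ^ k * X 3 ^ l) := by
  have h1 : (X 0 * X 2 - X 1 * X 2 : R) = (X 0 - X 1) * X 2 := by ring
  have h2 : (X 0 * X 3 - X 1 * X 3 : R) = (X 0 - X 1) * X 3 := by ring
  unfold lift lines
  split_ifs with hl hl'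
  · obtain ⟨i, rfl⟩ := Nat.exists_eq_add_of_le hl.le
    obtain rfl : k = (l + i) + x + (n + y) + i := by omega
    simp only [map_mul, map_pow, map_sub, segre_a, segre_b, segre_c, segre_d, h1, h2,
      Nat.add_sub_cancel_left, mul_pow]
    ring
  · obtain ⟨i, rfl⟩ := Nat.exists_eq_add_of_le (not_lt.1 hl)
    obtain ⟨i', hi'⟩ := Nat.exists_eq_add_of_le hl'
    obtain rfl : k = m + x + i' := by omega
    rw [show m + n + y - (m + i) = i' by omega]
    have e1 : (X 1 ^ i' * X 1 ^ i : R) = X 1 ^ n * X 1 ^ y := by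
      rw [← pow_add, ← pow_add]; congr 1; omega
    simp only [map_mul, map_pow, map_sub, segre_a, segre_b, segre_c, segre_d, h2,
      Nat.add_sub_cancel_left, mul_pow]
    linear_combination (X 0 ^ (m + x) * X 2 ^ (m + x + i') * X 3 ^ (i + m) * (X 0 - X 1) ^ m) * e1
  · obtain ⟨i, rfl⟩ := Nat.exists_eq_add_of_le (not_le.1 hl').le
    rw [show 2 * m + n + x + y - (m + n + y + i) = k by omega]
    have e1 : (X 0 ^ k * X 0 ^ i : R) = X 0 ^ m * X 0 ^ x := by
      rw [← pow_add, ← pow_add]; congr 1; omega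
    simp only [map_mul, map_pow, map_sub, segre_a, segre_b, segre_d, h2,
      Nat.add_sub_cancel_left, mul_pow]
    linear_combination
      (X 2 ^ k * X 3 ^ (i + n + y + m) * X 1 ^ (n + y) * (X 0 - X 1) ^ m) * e1

/-- The basis elements of level `0`. -/
def lowest (m n : ℕ) (e : Level m n) : R := lift m n (e.1 0) (e.1 1) (e.1 3)

theorem segre_lowest {m n : ℕ} (e : Level m n) :
    segre (lowest m n e) = lines m n * monomial e.1 1 := by
  rw [lowest, segre_lift e.2, monomial_eq_prod]

theorem lines_ne_zero (m n : ℕ) : lines m n ≠ 0 := by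
  have h : (X 0 - X 1 : R) ≠ 0 := fun h => by
    simpa using congrArg (eval ![1, 0, 0, 0]) h
  exact mul_ne_zero (mul_ne_zero (pow_ne_zero _ (X_ne_zero _)) (pow_ne_zero _ (X_ne_zero _)))
    (pow_ne_zero _ h)

theorem linearIndependent_segre_lowest (m n : ℕ) :
    LinearIndependent ℂ (segre.toLinearMap ∘ lowest m n) := by
  have h := (linearIndependent_monomial.comp _ (Subtype.val_injective (p := fun e : Fin 4 →₀ ℕ =>
    e 2 + e 3 = e 0 + e 1 + (2 * m + n)))).map' (LinearMap.mulLeft ℂ (lines m n))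
    (LinearMap.ker_eq_bot.2 (mul_right_injective₀ (lines_ne_zero m n)))
  have e : segre.toLinearMap ∘ lowest m n = fun e : Level m n => lines m n * monomial e.1 1 :=
    funext segre_lowest
  rw [e]
  exact h

theorem mem_range_lowest {m n x y l : ℕ} (h : l ≤ x + y + (2 * m + n)) :
    lift m n x y l ∈ Set.range (lowest m n) :=
  ⟨⟨expo x y (x + y + (2 * m + n) - l) l, by simp; omega⟩, rfl⟩

/-! ### The recursion satisfied by the basis set. -/

/-- A member with `j = 0` is a `lift`; its exponents `x` and `y` come from the monomial multiplier,
and `l` is its `t`-degree. A member with index `j + 1` is `det` times the member with index `j` at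
the lower level, and the last family likewise loses one factor `det` while `d₂ - d₁` is unchanged.
-/
theorem basisSet_succ (d₁ d₂ : ℕ) :
    basisSet (d₁ + 1) (d₂ + 1) =
      Set.range (lowest (d₁ + 1) (d₂ + 1)) ∪ (fun f => det * f) '' basisSet d₁ d₂ := by
  ext f
  constructor
  · rintro ((((⟨j, hj, i, h1, h2, α, γ, rfl⟩ | ⟨j, hj, i, h1, h2, α, β, δ, rfl⟩) |
      ⟨j, hj, i, h1, h2, α, γ, δ, rfl⟩) | ⟨j, hj, α, δ, rfl⟩) | ⟨α, β, γ, δ, hn, rfl⟩)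
    · rcases j with _ | j
      · left
        convert mem_range_lowest (m := d₁ + 1) (n := d₂ + 1) (x := α) (y := γ)
          (l := d₁ + 1 - i) (by omega) using 1
        rw [lift, if_pos (by omega), A, show d₁ + 1 - (d₁ + 1 - i) = i by omega]
        simp only [Nat.sub_zero]
        ring
      · right
        refine ⟨_, .inl <| .inl <| .inl <| .inl ⟨j, by omega, i, h1, by omega, α, γ, rfl⟩, ?_⟩
        simp only [A, det, Nat.add_sub_add_right]
        ring
    · rcases j with _ | j
      · left
        convert mem_range_lowest (m := d₁ + 1) (n := d₂ + 1) (x := α + β) (y := δ)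
          (l := d₁ + 1 + (d₂ + 1) + δ + (β + i)) (by omega) using 1
        rw [lift, if_neg (by omega), if_neg (by omega), B,
          show 2 * (d₁ + 1) + (d₂ + 1) + (α + β) + δ - (d₁ + 1 + (d₂ + 1) + δ + (β + i))
            = α + (d₁ + 1 - i) by omega]
        simp only [Nat.sub_zero, Nat.add_sub_cancel_left]
        ring
      · right
        refine ⟨_, .inl <| .inl <| .inl <| .inr ⟨j, by omega, i, h1, by omega, α, β, δ, rfl⟩, ?_⟩
        simp only [B, det, Nat.add_sub_add_right]
        ring
    · rcases j with _ | j
      · left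
        convert mem_range_lowest (m := d₁ + 1) (n := d₂ + 1) (x := α) (y := γ + δ)
          (l := d₁ + 1 + (δ + (d₂ + 1 - i))) (by omega) using 1
        rw [lift, if_neg (by omega), if_pos (by omega), C,
          show d₁ + 1 + (d₂ + 1) + (γ + δ) - (d₁ + 1 + (δ + (d₂ + 1 - i))) = γ + i by omega]
        simp only [Nat.sub_zero, Nat.add_sub_cancel_left]
        ring
      · right
        refine ⟨_, .inl <| .inl <| .inr ⟨j, by omega, i, h1, by omega, α, γ, δ, rfl⟩, ?_⟩
        simp only [C, det, Nat.add_sub_add_right]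
        ring
    · rcases j with _ | j
      · left
        convert mem_range_lowest (m := d₁ + 1) (n := d₂ + 1) (x := α) (y := δ)
          (l := d₁ + 1 + (d₂ + 1 + δ)) (by omega) using 1
        rw [lift, if_neg (by omega), if_pos (by omega), D,
          show d₁ + 1 + (d₂ + 1) + δ - (d₁ + 1 + (d₂ + 1 + δ)) = 0 by omega]
        simp only [Nat.sub_zero, Nat.add_sub_cancel_left]
        ring
      · right
        refine ⟨_, .inl <| .inr ⟨j, by omega, α, δ, rfl⟩, ?_⟩
        simp only [D, det, Nat.add_sub_add_right]
        ring
    · right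
      refine ⟨_, .inr ⟨α, β, γ, δ, by omega, rfl⟩, ?_⟩
      simp only [det]
      ring
  · rintro (⟨⟨e, he⟩, rfl⟩ | ⟨f, hf, rfl⟩)
    · obtain ⟨x, y, l, hl, he'⟩ : ∃ x y l, l ≤ x + y + (2 * (d₁ + 1) + (d₂ + 1)) ∧
          lowest (d₁ + 1) (d₂ + 1) ⟨e, he⟩ = lift (d₁ + 1) (d₂ + 1) x y l :=
        ⟨e 0, e 1, e 3, by omega, rfl⟩
      rw [he', lift]
      split_ifs with h1 h2
      · refine .inl <| .inl <| .inl <| .inl ⟨0, by omega, d₁ + 1 - l, by omega, by omega, x, y, ?_⟩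
        rw [A, show d₁ + 1 - 0 - (d₁ + 1 - l) = l by omega]
        simp only [Nat.sub_zero]
        ring
      -- At this endpoint the exponent of `c` is zero, which `C` excludes by `1 ≤ i`; the element
      -- belongs to `D`.
      · by_cases h3 : l = d₁ + 1 + (d₂ + 1) + y
        · subst h3
          refine .inl <| .inr ⟨0, by omega, x, y, ?_⟩
          rw [D, Nat.sub_self, show d₁ + 1 + (d₂ + 1) + y - (d₁ + 1) = d₂ + 1 + y by omega]
          simp only [Nat.sub_zero]
          ring
        -- The same polynomial may arise from several triples `(i, γ, δ)`; the largest admissible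
        -- `i` is taken, so that the leftover exponents are nonnegative. The same choice is made for
        -- `B` below.
        · obtain ⟨i, γ, δ, hi1, hi2, hγ, hδ⟩ : ∃ i γ δ, 1 ≤ i ∧ i ≤ d₂ + 1 ∧
              d₁ + 1 + (d₂ + 1) + y - l = γ + i ∧ l - (d₁ + 1) = δ + (d₂ + 1 - i) :=
            ⟨min (d₁ + 1 + (d₂ + 1) + y - l) (d₂ + 1),
              d₁ + 1 + (d₂ + 1) + y - l - min (d₁ + 1 + (d₂ + 1) + y - l) (d₂ + 1),
              l - (d₁ + 1) - (d₂ + 1 - min (d₁ + 1 + (d₂ + 1) + y - l) (d₂ + 1)),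
              by omega, by omega, by omega, by omega⟩
          refine .inl <| .inl <| .inr ⟨0, by omega, i, hi1, by omega, x, γ, δ, ?_⟩
          rw [C, hγ, hδ]
          simp only [Nat.sub_zero]
          ring
      · obtain ⟨i, α, β, hi1, hi2, hα, hβ⟩ : ∃ i α β, 1 ≤ i ∧ i ≤ d₁ + 1 ∧
            2 * (d₁ + 1) + (d₂ + 1) + x + y - l = α + (d₁ + 1 - i) ∧
            l - (d₁ + 1 + (d₂ + 1) + y) = β + i :=
          ⟨min (l - (d₁ + 1 + (d₂ + 1) + y)) (d₁ + 1),
            2 * (d₁ + 1) + (d₂ + 1) + x + y - l -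
              (d₁ + 1 - min (l - (d₁ + 1 + (d₂ + 1) + y)) (d₁ + 1)),
            l - (d₁ + 1 + (d₂ + 1) + y) - min (l - (d₁ + 1 + (d₂ + 1) + y)) (d₁ + 1),
            by omega, by omega, by omega, by omega⟩
        refine .inl <| .inl <| .inl <| .inr ⟨0, by omega, i, hi1, by omega, α, β, y, ?_⟩
        rw [B, hα, hβ]
        simp only [Nat.sub_zero]
        ring
    · rcases hf with ((((⟨j, hj, i, h1, h2, α, γ, rfl⟩ | ⟨j, hj, i, h1, h2, α, β, δ, rfl⟩) |
        ⟨j, hj, i, h1, h2, α, γ, δ, rfl⟩) | ⟨j, hj, α, δ, rfl⟩) | ⟨α, β, γ, δ, hn, rfl⟩)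
      · refine .inl <| .inl <| .inl <| .inl ⟨j + 1, by omega, i, h1, by omega, α, γ, ?_⟩
        simp only [A, det, Nat.add_sub_add_right]
        ring
      · refine .inl <| .inl <| .inl <| .inr ⟨j + 1, by omega, i, h1, by omega, α, β, δ, ?_⟩
        simp only [B, det, Nat.add_sub_add_right]
        ring
      · refine .inl <| .inl <| .inr ⟨j + 1, by omega, i, h1, by omega, α, γ, δ, ?_⟩
        simp only [C, det, Nat.add_sub_add_right]
        ring
      · refine .inl <| .inr ⟨j + 1, by omega, α, δ, ?_⟩
        simp only [D, det, Nat.add_sub_add_right]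
        ring
      · refine .inr ⟨α, β, γ, δ, by omega, ?_⟩
        simp only [det]
        ring

theorem basisSet_zero (d₂ : ℕ) : basisSet 0 d₂ =
    {f | ∃ α β γ δ : ℕ, d₂ ≤ γ + δ ∧ f = a ^ α * b ^ β * c ^ γ * d ^ δ} := by
  ext f
  constructor
  · rintro ((((⟨j, hj, _⟩ | ⟨j, hj, _⟩) | ⟨j, hj, _⟩) | ⟨j, hj, _⟩) | ⟨α, β, γ, δ, hn, rfl⟩)
    iterate 4 omega
    exact ⟨α, β, γ, δ, hn, by ring⟩
  · rintro ⟨α, β, γ, δ, hn, rfl⟩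
    exact .inr ⟨α, β, γ, δ, hn, by ring⟩

/-! ### Linear independence -/

theorem linearIndepOn_basisSet (d₁ d₂ : ℕ) (h : d₁ ≤ d₂) :
    LinearIndepOn ℂ id (basisSet d₁ d₂) := by
  induction d₁ generalizing d₂ with
  | zero =>
    refine linearIndependent_monomial.linearIndepOn_id.mono ?_
    rw [basisSet_zero]
    rintro f ⟨α, β, γ, δ, -, rfl⟩
    exact ⟨_, (prod_eq_monomial α β γ δ).symm⟩
  | succ d₁ ih =>
    obtain ⟨d₂, rfl⟩ : ∃ k, d₂ = k + 1 := ⟨d₂ - 1, by omega⟩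
    rw [basisSet_succ]
    have h1 := linearIndependent_segre_lowest (d₁ + 1) (d₂ + 1)
    -- The first part remains independent after `segre`, so its span meets the kernel trivially, and
    -- the multiples of `det` lie in the kernel.
    refine LinearIndepOn.id_union h1.of_comp.linearIndepOn_id ?_ ?_
    · have := (ih d₂ (by omega)).map_injOn (LinearMap.mulLeft ℂ det)
        (mul_right_injective₀ det_ne_zero).injOn
      exact this.id_image
    · refine (Submodule.range_ker_disjoint h1).mono_right ?_
      rw [Submodule.span_le]
      rintro _ ⟨f, -, rfl⟩
      simp [segre_det]

/-! ### Spanning -/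

theorem mem_span_of_mem_span_cd_pow (n : ℕ) {f : R} (hf : f ∈ Ideal.span {c, d} ^ n) :
    f ∈ Submodule.span ℂ {f | ∃ α β γ δ : ℕ, n ≤ γ + δ ∧ f = a ^ α * b ^ β * c ^ γ * d ^ δ} := by
  induction n generalizing f with
  | zero =>
    refine mem_of_monomial_mem (fun e => Submodule.subset_span ?_) f
    exact ⟨e 0, e 1, e 2, e 3, by omega, monomial_eq_prod e⟩
  | succ n ih =>
    have mul_mem : ∀ z ∈ ({c, d} : Set R), ∀ g ∈ Ideal.span {c, d} ^ n,
        z * g ∈ Submodule.span ℂ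
          {f | ∃ α β γ δ : ℕ, n + 1 ≤ γ + δ ∧ f = a ^ α * b ^ β * c ^ γ * d ^ δ} := by
      intro z hz g hg
      have := Submodule.mem_map_of_mem (f := LinearMap.mulLeft ℂ z) (ih hg)
      rw [Submodule.map_span] at this
      refine Submodule.span_mono ?_ this
      rintro _ ⟨_, ⟨α, β, γ, δ, hn, rfl⟩, rfl⟩
      rcases hz with rfl | rfl
      · exact ⟨α, β, γ + 1, δ, by omega, by simp; ring⟩
      · exact ⟨α, β, γ, δ + 1, by omega, by simp; ring⟩
    rw [pow_succ'] at hf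
    induction hf using Submodule.mul_induction_on' with
    | mem_mul_mem r hr s hs =>
      obtain ⟨x, y, rfl⟩ := Ideal.mem_span_pair.1 hr
      rw [show (x * c + y * d) * s = c * (x * s) + d * (y * s) by ring]
      exact add_mem (mul_mem c (by simp) _ (Ideal.mul_mem_left _ _ hs))
        (mul_mem d (by simp) _ (Ideal.mul_mem_left _ _ hs))
    | add x _ y _ hx hy => exact add_mem hx hy

/-! ### The image of `J` under `segre`: divisibility and balance. -/

theorem dvd_segre_of_mem {p q z : R} (hp : z ∣ segre p) (hq : z ∣ segre q) {m : ℕ} {f : R}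
    (hf : f ∈ Ideal.span {p, q} ^ m) : z ^ m ∣ segre f := by
  have hle : (Ideal.span {p, q} ^ m).map segre ≤ Ideal.span {z ^ m} := by
    rw [Ideal.map_pow, ← Ideal.span_singleton_pow]
    refine Ideal.pow_right_mono ?_ _
    rw [Ideal.map_span, Ideal.span_le, Set.image_pair]
    rintro _ (rfl | rfl)
    · exact Ideal.mem_span_singleton.2 hp
    · exact Ideal.mem_span_singleton.2 hq
  exact Ideal.mem_span_singleton.1 (hle (Ideal.mem_map_of_mem _ hf))

theorem isRelPrime_X_of_eval {i : Fin 4} {p : R} (x : Fin 4 → ℂ) (hx : x i = 0)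
    (hp : eval x p ≠ 0) : IsRelPrime (X i) p := by
  refine (X_prime.irreducible.isRelPrime_iff_not_dvd).2 fun ⟨q, hq⟩ => hp ?_
  simp [hq, hx]

/-- Each of the three ideals maps into the principal ideal of one linear form `s`, `t` or `s - t`.
These are pairwise coprime, so the product of their powers divides the image. -/
theorem lines_dvd_segre {m n : ℕ} {f : R} (hf : f ∈ J m n) : lines m n ∣ segre f := by
  obtain ⟨⟨h1, h2⟩, h3⟩ := hf
  have r1 : IsRelPrime (X 0 : R) (X 1) := isRelPrime_X_of_eval ![0, 1, 0, 0] (by simp) (by simp)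
  have r2 : IsRelPrime (X 0 : R) (X 0 - X 1) :=
    isRelPrime_X_of_eval ![0, 1, 0, 0] (by simp) (by simp)
  have r3 : IsRelPrime (X 1 : R) (X 0 - X 1) :=
    isRelPrime_X_of_eval ![1, 0, 0, 0] (by simp) (by simp)
  refine IsRelPrime.mul_dvd (IsRelPrime.mul_left r2.pow r3.pow)
    (IsRelPrime.mul_dvd r1.pow ?_ ?_) ?_
  · exact dvd_segre_of_mem (by simp) (by simp) h1
  · exact dvd_segre_of_mem (by simp) (by simp) h2
  · refine dvd_segre_of_mem ⟨X 2, ?_⟩ ⟨X 3, ?_⟩ h3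
    · simp; ring
    · simp; ring

/-- The grading for which the image of `segre` has degree `0`. -/
def balance : Fin 4 → ℤ := ![1, 1, -1, -1]

theorem isWeightedHomogeneous_segre (f : R) : IsWeightedHomogeneous balance (segre f) 0 := by
  refine mem_of_monomial_mem
    (W := (weightedHomogeneousSubmodule ℂ balance 0).comap segre.toLinearMap) (fun e => ?_) f
  rw [Submodule.mem_comap, AlgHom.toLinearMap_apply, segre_monomial]
  refine isWeightedHomogeneous_monomial _ _ _ ?_
  simp [Finsupp.weight_apply, Finsupp.sum_fintype, Fin.sum_univ_four, balance]
  ring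

theorem isWeightedHomogeneous_lines (m n : ℕ) :
    IsWeightedHomogeneous balance (lines m n) (2 * m + n) := by
  have h0 : IsWeightedHomogeneous balance (X 0 : R) 1 := isWeightedHomogeneous_X ℂ _ 0
  have h1 : IsWeightedHomogeneous balance (X 1 : R) 1 := isWeightedHomogeneous_X ℂ _ 1
  have h01 : IsWeightedHomogeneous balance (X 0 - X 1 : R) 1 :=
    (weightedHomogeneousSubmodule ℂ balance 1).sub_mem h0 h1
  have := ((h0.pow m).mul (h1.pow n)).mul (h01.pow m)
  rwa [show m • (1 : ℤ) + n • (1 : ℤ) + m • (1 : ℤ) = 2 * m + n by simp; ring] at this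

theorem segre_mem_span {m n : ℕ} {f : R} (hf : f ∈ J m n) :
    segre f ∈ (Submodule.span ℂ (Set.range (lowest m n))).map segre.toLinearMap := by
  obtain ⟨h, hh⟩ := lines_dvd_segre hf
  -- The cofactor `h` need not be taken homogeneous: `segre f` equals its own component of degree
  -- `0`, and the projection to that component is linear, so `h` can be treated monomial by
  -- monomial. A monomial survives exactly when its exponent belongs to `Level m n`.
  rw [← (isWeightedHomogeneous_segre f).weightedHomogeneousComponent_same, hh]
  refine mem_of_monomial_mem (W := ((Submodule.span ℂ (Set.range (lowest m n))).map
    segre.toLinearMap).comap (weightedHomogeneousComponent balance 0 ∘ₗ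
      LinearMap.mulLeft ℂ (lines m n))) (fun e => ?_) h
  have hom : IsWeightedHomogeneous balance (lines m n * monomial e 1)
      (2 * m + n + (e 0 + e 1 - e 2 - e 3)) := by
    refine (isWeightedHomogeneous_lines m n).mul (isWeightedHomogeneous_monomial _ _ _ ?_)
    simp [Finsupp.weight_apply, Finsupp.sum_fintype, Fin.sum_univ_four, balance]
    ring
  rw [Submodule.mem_comap, LinearMap.comp_apply, LinearMap.mulLeft_apply]
  by_cases he : (2 * m + n + (e 0 + e 1 - e 2 - e 3) : ℤ) = 0
  · rw [he] at hom
    rw [hom.weightedHomogeneousComponent_same]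
    refine ⟨lowest m n ⟨e, by omega⟩, Submodule.subset_span ⟨_, rfl⟩, segre_lowest _⟩
  · rw [hom.weightedHomogeneousComponent_ne _ (Ne.symm he)]
    exact zero_mem _

theorem basisSet_subset_J {d₁ d₂ : ℕ} (h : d₁ ≤ d₂) : basisSet d₁ d₂ ⊆ J d₁ d₂ :=
  (basisSet_subset_span_generators d₁ d₂).trans (Ideal.span_le.2 (generators_subset_J h))

/-- Subtracting a combination `l` of `lowest` elements with the same image under `segre` leaves `det
* g`. Since `l` is itself in `J`, so is `det * g`; cancelling `det` puts `g` in the smaller ideal,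
where the induction hypothesis applies. -/
theorem mem_span_basisSet (d₁ d₂ : ℕ) (h : d₁ ≤ d₂) {f : R} (hf : f ∈ J d₁ d₂) :
    f ∈ Submodule.span ℂ (basisSet d₁ d₂) := by
  induction d₁ generalizing d₂ f with
  | zero =>
    rw [basisSet_zero]
    exact mem_span_of_mem_span_cd_pow _ hf.1.2
  | succ d₁ ih =>
    obtain ⟨d₂, rfl⟩ : ∃ k, d₂ = k + 1 := ⟨d₂ - 1, by omega⟩
    obtain ⟨l, hl, hlf⟩ := segre_mem_span hf
    have hl' : l ∈ Submodule.span ℂ (basisSet (d₁ + 1) (d₂ + 1)) := by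
      refine Submodule.span_mono ?_ hl
      rw [basisSet_succ]
      exact Set.subset_union_left
    have hlJ : l ∈ J (d₁ + 1) (d₂ + 1) := by
      have : Submodule.span ℂ (basisSet (d₁ + 1) (d₂ + 1)) ≤
          (J (d₁ + 1) (d₂ + 1)).restrictScalars ℂ := Submodule.span_le.2 (basisSet_subset_J h)
      exact this hl'
    obtain ⟨g, hg⟩ : det ∣ f - l := det_dvd_of_segre_eq_zero <| by
      rw [map_sub, sub_eq_zero]; exact hlf.symm
    have hgJ : g ∈ J d₁ d₂ := mem_J_of_det_mul_mem (hg ▸ sub_mem hf hlJ)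
    rw [← sub_add_cancel f l, hg]
    refine add_mem ?_ hl'
    have := Submodule.mem_map_of_mem (f := LinearMap.mulLeft ℂ det) (ih d₂ (by omega) hgJ)
    rw [Submodule.map_span] at this
    refine Submodule.span_mono ?_ this
    rw [basisSet_succ]
    exact Set.subset_union_right

theorem span_basisSet {d₁ d₂ : ℕ} (h : d₁ ≤ d₂) :
    Submodule.span ℂ (basisSet d₁ d₂) = (J d₁ d₂).restrictScalars ℂ :=
  le_antisymm (Submodule.span_le.2 (basisSet_subset_J h)) fun _ => mem_span_basisSet d₁ d₂ h

theorem span_generators {d₁ d₂ : ℕ} (h : d₁ ≤ d₂) :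
    Ideal.span (generators d₁ d₂) = J d₁ d₂ := by
  refine le_antisymm (Ideal.span_le.2 (generators_subset_J h)) fun f hf => ?_
  have : Submodule.span ℂ (basisSet d₁ d₂) ≤ (Ideal.span (generators d₁ d₂)).restrictScalars ℂ :=
    Submodule.span_le.2 (basisSet_subset_span_generators d₁ d₂)
  exact this (mem_span_basisSet d₁ d₂ h hf)

end

end TripleIdeal

theorem theorem4p1 (d₁ d₂ : ℕ) (h : d₁ ≤ d₂) :
    -- generation
    Ideal.span (TripleIdeal.generators d₁ d₂) = TripleIdeal.J d₁ d₂ ∧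
    -- bidegrees
    (∀ i j : ℕ, j ≤ d₁ → 1 ≤ i → i ≤ d₁ - j →
      TripleIdeal.HasBidegree (TripleIdeal.A d₁ d₂ i j) (d₁ + d₂ - j + i) (d₁ - i)) ∧
    (∀ i j : ℕ, j ≤ d₁ → 1 ≤ i → i ≤ d₁ - j →
      TripleIdeal.HasBidegree (TripleIdeal.B d₁ d₂ i j) (d₁ - i) (d₁ + d₂ - j + i)) ∧
    (∀ i j : ℕ, j ≤ d₁ → 1 ≤ i → i ≤ d₂ - j →
      TripleIdeal.HasBidegree (TripleIdeal.C d₁ d₂ i j) (d₁ + i) (d₁ + d₂ - j - i)) ∧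
    (∀ j : ℕ, j ≤ d₁ →
      TripleIdeal.HasBidegree (TripleIdeal.D d₁ d₂ j) d₁ (d₁ + d₂ - j)) ∧
    -- number of generators for a fixed j
    (∀ j : ℕ, j ≤ d₁ →
      (TripleIdeal.rowA d₁ d₂ j).ncard = d₁ - j ∧
      (TripleIdeal.rowB d₁ d₂ j).ncard = d₁ - j ∧
      (TripleIdeal.rowC d₁ d₂ j).ncard = d₂ - j) ∧
    (TripleIdeal.famD d₁ d₂).ncard = d₁ + 1 ∧
    -- each family is characterized, among the generators, by the bidegree
    (∀ g ∈ TripleIdeal.generators d₁ d₂, ∀ x y : ℕ, TripleIdeal.HasBidegree g x y →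
      (g ∈ TripleIdeal.famA d₁ d₂ ↔ y < d₁) ∧
      (g ∈ TripleIdeal.famB d₁ d₂ ↔ x < d₁) ∧
      (g ∈ TripleIdeal.famC d₁ d₂ ↔ d₁ < x ∧ d₁ ≤ y) ∧
      (g ∈ TripleIdeal.famD d₁ d₂ ↔ x = d₁)) ∧
    -- the basis of J over ℂ
    LinearIndepOn ℂ id (TripleIdeal.basisSet d₁ d₂) ∧
    Submodule.span ℂ (TripleIdeal.basisSet d₁ d₂) =
      (TripleIdeal.J d₁ d₂).restrictScalars ℂ := by
  exact ⟨TripleIdeal.span_generators h,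
    fun _ _ hj _ hi => TripleIdeal.hasBidegree_A h hj hi,
    fun _ _ hj _ hi => TripleIdeal.hasBidegree_B h hj hi,
    fun _ _ hj _ hi => TripleIdeal.hasBidegree_C h hj hi,
    fun _ hj => TripleIdeal.hasBidegree_D h hj,
    fun _ hj => ⟨TripleIdeal.ncard_rowA h hj, TripleIdeal.ncard_rowB h hj,
      TripleIdeal.ncard_rowC h hj⟩,
    TripleIdeal.ncard_famD h,
    fun _ hg _ _ hxy => TripleIdeal.mem_fam_iff_bidegree h hg hxy,
    TripleIdeal.linearIndepOn_basisSet d₁ d₂ h,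
    TripleIdeal.span_basisSet h⟩
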